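/- Let $n$ be a positive even integer and let $(\mathcal C,\mathbb E,\mathfrak s)$ be an $n$-exangulated category in the sense of Herschend–Liu–Nakaoka. Let $S(\mathcal C)$ be the category whose objects are the distinguished $n$-exangles $$A^\bullet:\ A_0\xrightarrow{\alpha_0}A_1\xrightarrow{\alpha_1}\cdots\xrightarrow{\alpha_n}A_{n+1}\overset{\delta}{\dashrightarrow},\qquad \delta\in\mathbb E(A_{n+1},A_0),$$ and whose morphisms from $A^\bullet$ to $B^\bullet:\ B_0\xrightarrow{\beta_0}\cdots\xrightarrow{\beta_n}B_{n+1}\overset{\delta'}{\dashrightarrow}$ are the morphisms of complexes $\varphi^\bullet=(\varphi_0,\dots,\varphi_{n+1})$ with $(\varphi_0)_*\delta=(\varphi_{n+1})^*\delta'$, added componentwise. Let $\mathcal R_2$ be the ideal of $S(\mathcal C)$ consisting of the morphisms $\varphi^\bullet:A^\bullet\to B^\bullet$ such that $\varphi_{n+1}$ factors through $\beta_n$. Then the ideal quotient $S(\mathcal C)/\mathcal R_2$, with the additive structure inherited from $S(\mathcal C)$, is an abelian category. Moreover, let $\varphi^\bullet:A^\bullet\to B^\bullet$ be a morphism in $S(\mathcal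 C)$ and let $I^\bullet:\ B_0\xrightarrow{e_0}E_1\xrightarrow{e_1}\cdots\xrightarrow{e_{n-1}}E_n\xrightarrow{e_n}A_{n+1}$ be any complex realizing the extension $(\varphi_0)_*\delta=(\varphi_{n+1})^*\delta'$. (1) Let $\pi^\bullet=(\varphi_0,g_1,\dots,g_n,1):A^\bullet\to I^\bullet$ be any morphism of complexes whose mapping cocone $$A_0\to A_1\oplus B_0\to A_2\oplus E_1\to\cdots\to A_n\oplus E_{n-1}\to E_n,$$ with differentials $\begin{bmatrix}\alpha_0\\ \varphi_0\end{bmatrix}$, $\begin{bmatrix}\alpha_i&0\\ g_i&-e_{i-1}\end{bmatrix}$ $(1\le i\le n-1)$, $\begin{bmatrix}g_n&-e_{n-1}\end{bmatrix}$, realizes $(e_n)^*\delta$. Then the morphism $(1,[1\ 0],\dots,[1\ 0],e_n)$ from this $n$-exangle to $A^\bullet$ is a kernel of $\varphi^\bullet$ in $S(\mathcal C)/\mathcal R_2$. (2) Let $\iota^\bullet=(1,h_1,\dots,h_n,\varphi_{n+1}):I^\bullet\to B^\bullet$ be any morphism of complexes whose mapping cone $$E_1\to E_2\oplus B_1\to\cdots\to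 E_n\oplus B_{n-1}\to A_{n+1}\oplus B_n\to B_{n+1},$$ with differentials $\begin{bmatrix}-e_1\\ h_1\end{bmatrix}$, $\begin{bmatrix}-e_{i+1}&0\\ h_{i+1}&\beta_i\end{bmatrix}$ $(1\le i\le n-1)$, $\begin{bmatrix}\varphi_{n+1}&\beta_n\end{bmatrix}$, realizes $(e_0)_*\delta'$. Then the morphism $\left(e_0,\begin{bmatrix}0\\1\end{bmatrix},\dots,\begin{bmatrix}0\\1\end{bmatrix},1\right)$ from $B^\bullet$ to this $n$-exangle is a cokernel of $\varphi^\bullet$ in $S(\mathcal C)/\mathcal R_2$. (By the axioms, such $I^\bullet$, $\pi^\bullet$ and $\iota^\bullet$ always exist.) -/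

import Mathlib

open CategoryTheory CategoryTheory.Limits Opposite

universe w v u

namespace NExangulated

section Extensions

variable {C : Type u} [Category.{v} C]

/-- The abelian group `𝔼(D, A)` of extensions `δ` with end terms `A` (on the left) and `D` (on the
right), for a bifunctor `𝔼 : Cᵒᵖ × C → Ab`. -/
abbrev Extn (E : Cᵒᵖ ⥤ C ⥤ AddCommGrpCat.{w}) (D A : C) : Type w :=
  ((E.obj (op D)).obj A : Type w)

variable {E : Cᵒᵖ ⥤ C ⥤ AddCommGrpCat.{w}}

/-- `a_* δ = 𝔼(D, a)(δ)`. -/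
def push {A A' D : C} (a : A ⟶ A') (δ : Extn E D A) : Extn E D A' :=
  ((E.obj (op D)).map a).hom δ

/-- `c^* δ = 𝔼(c, A)(δ)`. -/
def pull {A D D' : C} (c : D' ⟶ D) (δ : Extn E D A) : Extn E D' A :=
  ((E.map c.op).app A).hom δ

lemma push_id {A D : C} (δ : Extn E D A) : push (𝟙 A) δ = δ := by
  simp [push]

lemma pull_id {A D : C} (δ : Extn E D A) : pull (𝟙 D) δ = δ := by
  simp [pull]

lemma push_comp {A A' A'' D : C} (a : A ⟶ A') (a' : A' ⟶ A'') (δ : Extn E D A) :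
    push (a ≫ a') δ = push a' (push a δ) := by
  simp [push]

lemma pull_comp {A D D' D'' : C} (c : D'' ⟶ D') (c' : D' ⟶ D) (δ : Extn E D A) :
    pull (c ≫ c') δ = pull c (pull c' δ) := by
  simp [pull]

lemma push_pull {A A' D D' : C} (a : A ⟶ A') (c : D' ⟶ D) (δ : Extn E D A) :
    push a (pull c δ) = pull c (push a δ) := by
  simp only [push, pull, ← AddCommGrpCat.comp_apply, (E.map c.op).naturality]

variable [Preadditive C]

lemma add_push [∀ X, (E.obj X).Additive] {A A' D : C} (a b : A ⟶ A') (δ : Extn E D A) :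
    push (a + b) δ = push a δ + push b δ := by
  simp [push, Functor.map_add]

lemma add_pull [E.Additive] {A D D' : C} (c d : D' ⟶ D) (δ : Extn E D A) :
    pull (c + d) δ = pull c δ + pull d δ := by
  simp [pull, Functor.map_add]

lemma zero_push [∀ X, (E.obj X).Additive] {A A' D : C} (δ : Extn E D A) :
    push (0 : A ⟶ A') δ = 0 := by
  simp [push, Functor.map_zero]

lemma zero_pull [E.Additive] {A D D' : C} (δ : Extn E D A) :
    pull (0 : D' ⟶ D) δ = 0 := by
  simp [pull, Functor.map_zero]

lemma neg_push [∀ X, (E.obj X).Additive] {A A' D : C} (a : A ⟶ A') (δ : Extn E D A) :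
    push (-a) δ = -push a δ := by
  simp [push, Functor.map_neg]

lemma neg_pull [E.Additive] {A D D' : C} (c : D' ⟶ D) (δ : Extn E D A) :
    pull (-c) δ = -pull c δ := by
  simp [pull, Functor.map_neg]

end Extensions

section Complexes

variable {C : Type u} [Category.{v} C] [Preadditive C]

/-- A complex `X₀ ⟶ X₁ ⟶ ⋯ ⟶ Xₙ₊₁` in `C`, i.e. a cochain complex whose terms are zero outside the
degrees `0, …, n + 1`, with end terms `A` and `D`: its terms of degree `0` and `n + 1` are
identified with `A` and `D`. -/
structure EndedComplex (n : ℕ) (A D : C) where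
  /-- the complex -/
  cx : CochainComplex C ℕ
  isZero : ∀ i, n + 1 < i → IsZero (cx.X i)
  /-- the identification of `A` with the first term -/
  left : A ≅ cx.X 0
  /-- the identification of the last term with `D` -/
  right : cx.X (n + 1) ≅ D

namespace EndedComplex

variable {n : ℕ} {A D : C}

/-- The first differential `A = X₀ ⟶ X₁`. -/
def dFirst (X : EndedComplex n A D) : A ⟶ X.cx.X 1 := X.left.hom ≫ X.cx.d 0 1

/-- The last differential `Xₙ ⟶ Xₙ₊₁ = D`. -/
def dLast (X : EndedComplex n A D) : X.cx.X n ⟶ D := X.cx.d n (n + 1) ≫ X.right.hom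

/-- Morphisms of complexes of the form `(a, f₁, …, fₙ, c)`, the components at the ends
being `a` and `c`. -/
@[ext]
structure Hom {A D A' D' : C} (X : EndedComplex n A D) (Y : EndedComplex n A' D')
    (a : A ⟶ A') (c : D ⟶ D') where
  /-- the morphism of complexes -/
  map : X.cx ⟶ Y.cx
  left_comm : X.left.hom ≫ map.f 0 = a ≫ Y.left.hom
  right_comm : map.f (n + 1) ≫ Y.right.hom = X.right.hom ≫ c

/-- Homotopy equivalence of complexes with the same end terms, through morphisms that are the
identity at both ends. -/
def HtpyEquiv (X Y : EndedComplex n A D) : Prop :=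
  ∃ (f : Hom X Y (𝟙 A) (𝟙 D)) (g : Hom Y X (𝟙 A) (𝟙 D)),
    Nonempty (Homotopy (f.map ≫ g.map) (𝟙 X.cx)) ∧ Nonempty (Homotopy (g.map ≫ f.map) (𝟙 Y.cx))

lemma HtpyEquiv.refl (X : EndedComplex n A D) : HtpyEquiv X X :=
  ⟨⟨𝟙 _, by simp, by simp⟩, ⟨𝟙 _, by simp, by simp⟩,
    ⟨Homotopy.ofEq (by simp)⟩, ⟨Homotopy.ofEq (by simp)⟩⟩

lemma HtpyEquiv.symm {X Y : EndedComplex n A D} (h : HtpyEquiv X Y) : HtpyEquiv Y X := by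
  obtain ⟨f, g, h₁, h₂⟩ := h
  exact ⟨g, f, h₂, h₁⟩

lemma HtpyEquiv.trans {X Y Z : EndedComplex n A D} (h : HtpyEquiv X Y) (h' : HtpyEquiv Y Z) :
    HtpyEquiv X Z := by
  obtain ⟨f, g, ⟨h₁⟩, ⟨h₂⟩⟩ := h
  obtain ⟨f', g', ⟨h₁'⟩, ⟨h₂'⟩⟩ := h'
  refine ⟨⟨f.map ≫ f'.map, ?_, ?_⟩, ⟨g'.map ≫ g.map, ?_, ?_⟩, ⟨?_⟩, ⟨?_⟩⟩
  · rw [HomologicalComplex.comp_f, ← Category.assoc, f.left_comm]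
    simpa using f'.left_comm
  · rw [HomologicalComplex.comp_f, Category.assoc, f'.right_comm]
    simpa using f.right_comm
  · rw [HomologicalComplex.comp_f, ← Category.assoc, g'.left_comm]
    simpa using g.left_comm
  · rw [HomologicalComplex.comp_f, Category.assoc, g.right_comm]
    simpa using g'.right_comm
  · have e := ((h₁'.compRight g.map).compLeft f.map).trans ((Homotopy.ofEq (by simp)).trans h₁)
    exact (Homotopy.ofEq (by simp)).trans e
  · have e := ((h₂.compRight f'.map).compLeft g'.map).trans ((Homotopy.ofEq (by simp)).trans h₂')
    exact (Homotopy.ofEq (by simp)).trans e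

/-- Homotopy equivalence, as an equivalence relation on the complexes with end terms `A`, `D`. -/
instance htpySetoid (n : ℕ) (A D : C) : Setoid (EndedComplex n A D) where
  r := HtpyEquiv
  iseqv := ⟨HtpyEquiv.refl, HtpyEquiv.symm, HtpyEquiv.trans⟩

end EndedComplex

/-- `⟨X, δ⟩` is an `n`-exangle: an attached complex (`(d₀)_* δ = 0` and `(dₙ)^* δ = 0`) such that
`C(-, X₀) ⟶ C(-, X₁) ⟶ ⋯ ⟶ C(-, Xₙ₊₁) ⟶ 𝔼(-, X₀)` and
`C(Xₙ₊₁, -) ⟶ ⋯ ⟶ C(X₁, -) ⟶ C(X₀, -) ⟶ 𝔼(Xₙ₊₁, -)` are exact. -/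
structure IsNExangle {E : Cᵒᵖ ⥤ C ⥤ AddCommGrpCat.{w}} {n : ℕ} {A D : C}
    (X : EndedComplex n A D) (δ : Extn E D A) : Prop where
  push_dFirst : push X.dFirst δ = 0
  pull_dLast : pull X.dLast δ = 0
  /-- exactness of the first sequence at `C(-, Xᵢ₊₁)` for `1 ≤ i + 1 ≤ n` -/
  exact_yoneda : ∀ (T : C) (i : ℕ), i + 1 ≤ n →
    Function.Exact (fun g : T ⟶ X.cx.X i => g ≫ X.cx.d i (i + 1))
      (fun g : T ⟶ X.cx.X (i + 1) => g ≫ X.cx.d (i + 1) (i + 2))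
  /-- exactness of the first sequence at `C(-, Xₙ₊₁)` -/
  exact_yoneda_last : ∀ T : C,
    Function.Exact (fun g : T ⟶ X.cx.X n => g ≫ X.dLast) (fun g : T ⟶ D => pull g δ)
  /-- exactness of the second sequence at `C(Xᵢ₊₁, -)` for `1 ≤ i + 1 ≤ n` -/
  exact_coyoneda : ∀ (T : C) (i : ℕ), i + 1 ≤ n →
    Function.Exact (fun g : X.cx.X (i + 2) ⟶ T => X.cx.d (i + 1) (i + 2) ≫ g)
      (fun g : X.cx.X (i + 1) ⟶ T => X.cx.d i (i + 1) ≫ g)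
  /-- exactness of the second sequence at `C(X₀, -)` -/
  exact_coyoneda_first : ∀ T : C,
    Function.Exact (fun g : X.cx.X 1 ⟶ T => X.dFirst ≫ g) (fun g : A ⟶ T => push g δ)

/-- `M` is a mapping cone of a morphism `f : X ⟶ Y` with `f₀ = 𝟙`: it is the complex
`X₁ ⟶ X₂ ⊕ Y₁ ⟶ X₃ ⊕ Y₂ ⟶ ⋯ ⟶ Xₙ₊₁ ⊕ Yₙ ⟶ Yₙ₊₁` with the differentials
`(-d, f₁)`, `(-d, 0; f, d)`, `(f, d)`. The maps `inl`, `inr`, `fst`, `snd` are the inclusions and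
projections that exhibit `Mᵢ` as `Xᵢ₊₁ ⊕ Yᵢ` for `i ≥ 1` (recall `Xₙ₊₂ = 0`)
and `M₀` as `X₁`. -/
structure MappingCone {n : ℕ} {A D D' : C} {X : EndedComplex n A D} {Y : EndedComplex n A D'}
    {c : D ⟶ D'} (f : X.Hom Y (𝟙 A) c) (M : EndedComplex n (X.cx.X 1) D') where
  inl : ∀ i, X.cx.X (i + 1) ⟶ M.cx.X i
  inr : ∀ i, Y.cx.X i ⟶ M.cx.X i
  fst : ∀ i, M.cx.X i ⟶ X.cx.X (i + 1)
  snd : ∀ i, M.cx.X i ⟶ Y.cx.X i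
  inr_zero : inr 0 = 0
  snd_zero : snd 0 = 0
  inl_fst : ∀ i, inl i ≫ fst i = 𝟙 _
  inr_snd : ∀ i, 1 ≤ i → inr i ≫ snd i = 𝟙 _
  inl_snd : ∀ i, inl i ≫ snd i = 0
  inr_fst : ∀ i, inr i ≫ fst i = 0
  total : ∀ i, fst i ≫ inl i + snd i ≫ inr i = 𝟙 _
  left_eq : M.left.hom = inl 0
  right_eq : M.right.hom = snd (n + 1) ≫ Y.right.hom
  d_eq : ∀ i, M.cx.d i (i + 1) =
    -(fst i ≫ X.cx.d (i + 1) (i + 2) ≫ inl (i + 1)) + fst i ≫ f.map.f (i + 1) ≫ inr (i + 1) +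
      snd i ≫ Y.cx.d i (i + 1) ≫ inr (i + 1)

/-- `N` is a mapping cocone of a morphism `h : X ⟶ Y` with `hₙ₊₁ = 𝟙`: it is the complex
`X₀ ⟶ X₁ ⊕ Y₀ ⟶ X₂ ⊕ Y₁ ⟶ ⋯ ⟶ Xₙ ⊕ Yₙ₋₁ ⟶ Yₙ` with the differentials
`(d, h₀)`, `(d, 0; h, -d)`, `(h, -d)`; this is the mapping cone in the opposite category.
The maps `inl`, `inr`, `fst`, `snd` are the inclusions and projections that exhibit
`N₀` as `X₀`, `Nᵢ₊₁` as `Xᵢ₊₁ ⊕ Yᵢ` for `i < n`, and `Nₙ₊₁` as `Yₙ`. -/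
structure MappingCocone {n : ℕ} {A B D : C} {X : EndedComplex n A D} {Y : EndedComplex n B D}
    {a : A ⟶ B} (h : X.Hom Y a (𝟙 D)) (N : EndedComplex n A (Y.cx.X n)) where
  inl : ∀ i, X.cx.X i ⟶ N.cx.X i
  inr : ∀ i, Y.cx.X i ⟶ N.cx.X (i + 1)
  fst : ∀ i, N.cx.X i ⟶ X.cx.X i
  snd : ∀ i, N.cx.X (i + 1) ⟶ Y.cx.X i
  inl_last : inl (n + 1) = 0
  fst_last : fst (n + 1) = 0
  inl_fst : ∀ i, i ≤ n → inl i ≫ fst i = 𝟙 _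
  inr_snd : ∀ i, i ≤ n → inr i ≫ snd i = 𝟙 _
  inl_snd : ∀ i, i ≤ n → inl (i + 1) ≫ snd i = 0
  inr_fst : ∀ i, i ≤ n → inr i ≫ fst (i + 1) = 0
  total_zero : fst 0 ≫ inl 0 = 𝟙 _
  total : ∀ i, i ≤ n → fst (i + 1) ≫ inl (i + 1) + snd i ≫ inr i = 𝟙 _
  left_eq : N.left.hom = X.left.hom ≫ inl 0
  right_eq : N.right.hom = snd n
  d_zero : N.cx.d 0 1 = fst 0 ≫ X.cx.d 0 1 ≫ inl 1 + fst 0 ≫ h.map.f 0 ≫ inr 0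
  d_succ : ∀ i, i + 1 ≤ n → N.cx.d (i + 1) (i + 2) =
    fst (i + 1) ≫ X.cx.d (i + 1) (i + 2) ≫ inl (i + 2) +
      fst (i + 1) ≫ h.map.f (i + 1) ≫ inr (i + 1) - snd i ≫ Y.cx.d i (i + 1) ≫ inr (i + 1)

end Complexes

section Realizations

variable {C : Type u} [Category.{v} C] [Preadditive C]

/-- A correspondence `𝔰` that associates to every extension `δ ∈ 𝔼(D, A)` a homotopy equivalence
class `𝔰(δ) = [X]` of complexes with end terms `A` and `D`. -/
abbrev Correspondence (E : Cᵒᵖ ⥤ C ⥤ AddCommGrpCat.{w}) (n : ℕ) :=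
  ∀ A D : C, Extn E D A → Quotient (EndedComplex.htpySetoid n A D)

variable {E : Cᵒᵖ ⥤ C ⥤ AddCommGrpCat.{w}} {n : ℕ}

/-- `X` realizes `δ`, i.e. `𝔰(δ) = [X]`; for an exact realization `𝔰` this says that `⟨X, δ⟩` is a
distinguished `n`-exangle. -/
def Realizes (s : Correspondence E n) {A D : C} (X : EndedComplex n A D) (δ : Extn E D A) : Prop :=
  s A D δ = Quotient.mk _ X

/-- `𝔰` is an exact realization of `𝔼`. -/
structure IsExactRealization (s : Correspondence E n) : Prop where
  /-- every morphism of extensions `(a, c) : δ ⟶ ρ` has a lift -/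
  exists_lift : ∀ {A D A' D' : C} (δ : Extn E D A) (ρ : Extn E D' A') (a : A ⟶ A') (c : D ⟶ D'),
    push a δ = pull c ρ → ∀ (X : EndedComplex n A D) (Y : EndedComplex n A' D'),
      Realizes s X δ → Realizes s Y ρ → Nonempty (X.Hom Y a c)
  isNExangle : ∀ {A D : C} (δ : Extn E D A) (X : EndedComplex n A D),
    Realizes s X δ → IsNExangle X δ
  /-- `𝔰(0) = [A ⟶ A ⟶ 0 ⟶ ⋯ ⟶ 0]` for `0 ∈ 𝔼(0, A)` -/
  realizes_zero_left : ∀ (A Z : C), IsZero Z → ∀ X : EndedComplex n A Z, IsIso (X.cx.d 0 1) →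
    (∀ i, 2 ≤ i → IsZero (X.cx.X i)) → Realizes s X (0 : Extn E Z A)
  /-- `𝔰(0) = [0 ⟶ ⋯ ⟶ 0 ⟶ A ⟶ A]` for `0 ∈ 𝔼(A, 0)` -/
  realizes_zero_right : ∀ (Z A : C), IsZero Z → ∀ X : EndedComplex n Z A,
    IsIso (X.cx.d n (n + 1)) → (∀ i, i < n → IsZero (X.cx.X i)) →
      Realizes s X (0 : Extn E A Z)

/-- `f` is an inflation: it is the first differential of a conflation. -/
def IsInflation (s : Correspondence E n) {A B : C} (f : A ⟶ B) : Prop :=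
  ∃ (D : C) (X : EndedComplex n A D) (δ : Extn E D A) (e : X.cx.X 1 ≅ B),
    Realizes s X δ ∧ X.dFirst ≫ e.hom = f

/-- `g` is a deflation: it is the last differential of a conflation. -/
def IsDeflation (s : Correspondence E n) {B D : C} (g : B ⟶ D) : Prop :=
  ∃ (A : C) (X : EndedComplex n A D) (δ : Extn E D A) (e : B ≅ X.cx.X n),
    Realizes s X δ ∧ e.hom ≫ X.dLast = g

/-- `(C, 𝔼, 𝔰)` is an `n`-exangulated category (for an additive category `C`, an additive bifunctor
`𝔼` and a correspondence `𝔰`). -/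
structure IsNExangulated (s : Correspondence E n) : Prop extends IsExactRealization s where
  inflation_comp : ∀ {A B D : C} (f : A ⟶ B) (g : B ⟶ D),
    IsInflation s f → IsInflation s g → IsInflation s (f ≫ g)
  deflation_comp : ∀ {A B D : C} (f : A ⟶ B) (g : B ⟶ D),
    IsDeflation s f → IsDeflation s g → IsDeflation s (f ≫ g)
  /-- `(𝟙, c) : c^* ρ ⟶ ρ` has a good lift -/
  exists_good_lift : ∀ {A D D' : C} (ρ : Extn E D' A) (c : D ⟶ D') (X : EndedComplex n A D)
    (Y : EndedComplex n A D'), Realizes s X (pull c ρ) → Realizes s Y ρ →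
      ∃ (f : X.Hom Y (𝟙 A) c) (M : EndedComplex n (X.cx.X 1) D'),
        Nonempty (MappingCone f M) ∧ Realizes s M (push X.dFirst ρ)
  /-- `(a, 𝟙) : δ ⟶ a_* δ` has a good lift -/
  exists_good_lift_op : ∀ {A B D : C} (δ : Extn E D A) (a : A ⟶ B) (X : EndedComplex n A D)
    (Y : EndedComplex n B D), Realizes s X δ → Realizes s Y (push a δ) →
      ∃ (h : X.Hom Y a (𝟙 D)) (N : EndedComplex n A (Y.cx.X n)),
        Nonempty (MappingCocone h N) ∧ Realizes s N (pull Y.dLast δ)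

end Realizations

section Exangles

variable {C : Type u} [Category.{v} C] [Preadditive C]
  {E : Cᵒᵖ ⥤ C ⥤ AddCommGrpCat.{w}} {n : ℕ}

/-- The objects of the category `S(C)`: distinguished `n`-exangles
`A = X₀ ⟶ X₁ ⟶ ⋯ ⟶ Xₙ ⟶ Xₙ₊₁ = D ⇢ δ`. -/
structure DistExangle (s : Correspondence E n) where
  A : C
  D : C
  X : EndedComplex n A D
  δ : Extn E D A
  realizes : Realizes s X δ

namespace DistExangle

variable {s : Correspondence E n}

/-- A morphism `(φ₀, φ₁, …, φₙ₊₁)` of distinguished `n`-exangles: a morphism of complexes with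
`(φ₀)_* δ = (φₙ₊₁)^* ρ`. Here `left` is `φ₀` and `right` is `φₙ₊₁`. -/
structure Hom (P Q : DistExangle s) where
  left : P.A ⟶ Q.A
  right : P.D ⟶ Q.D
  hom : P.X.Hom Q.X left right
  ext_comm : push left P.δ = pull right Q.δ

lemma Hom.ext_of {P Q : DistExangle s} {φ ψ : Hom P Q} (h₁ : φ.left = ψ.left)
    (h₂ : φ.right = ψ.right) (h₃ : φ.hom.map = ψ.hom.map) : φ = ψ := by
  obtain ⟨l, r, ⟨m, _, _⟩, _⟩ := φ
  obtain ⟨l', r', ⟨m', _, _⟩, _⟩ := ψ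
  dsimp at h₁ h₂ h₃
  subst h₁ h₂ h₃
  rfl

/-- The category `S(C)` of distinguished `n`-exangles. -/
instance : Category (DistExangle s) where
  Hom := Hom
  id P := ⟨𝟙 _, 𝟙 _, ⟨𝟙 _, by simp, by simp⟩, by rw [push_id, pull_id]⟩
  comp {P Q R} φ ψ :=
    { left := φ.left ≫ ψ.left
      right := φ.right ≫ ψ.right
      hom :=
        { map := φ.hom.map ≫ ψ.hom.map
          left_comm := by
            rw [HomologicalComplex.comp_f, ← Category.assoc, φ.hom.left_comm, Category.assoc,
              ψ.hom.left_comm, Category.assoc]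
          right_comm := by
            rw [HomologicalComplex.comp_f, Category.assoc, ψ.hom.right_comm, ← Category.assoc,
              φ.hom.right_comm, Category.assoc] }
      ext_comm := by
        rw [push_comp, φ.ext_comm, push_pull, ψ.ext_comm, pull_comp] }
  id_comp _ := Hom.ext_of (Category.id_comp _) (Category.id_comp _) (Category.id_comp _)
  comp_id _ := Hom.ext_of (Category.comp_id _) (Category.comp_id _) (Category.comp_id _)
  assoc _ _ _ := Hom.ext_of (Category.assoc _ _ _) (Category.assoc _ _ _) (Category.assoc _ _ _)

@[ext]
lemma hom_ext {P Q : DistExangle s} {φ ψ : P ⟶ Q} (h₁ : φ.left = ψ.left)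
    (h₂ : φ.right = ψ.right) (h₃ : φ.hom.map = ψ.hom.map) : φ = ψ :=
  Hom.ext_of h₁ h₂ h₃

@[simp] lemma comp_left {P Q R : DistExangle s} (φ : P ⟶ Q) (ψ : Q ⟶ R) :
    (φ ≫ ψ).left = φ.left ≫ ψ.left := rfl

@[simp] lemma comp_right {P Q R : DistExangle s} (φ : P ⟶ Q) (ψ : Q ⟶ R) :
    (φ ≫ ψ).right = φ.right ≫ ψ.right := rfl

@[simp] lemma comp_map {P Q R : DistExangle s} (φ : P ⟶ Q) (ψ : Q ⟶ R) :
    (φ ≫ ψ).hom.map = φ.hom.map ≫ ψ.hom.map := rfl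

variable [E.Additive] [∀ X, (E.obj X).Additive]

instance (P Q : DistExangle s) : Zero (P ⟶ Q) where
  zero := ⟨0, 0, ⟨0, by simp, by simp⟩, by rw [zero_push, zero_pull]⟩

instance (P Q : DistExangle s) : Add (P ⟶ Q) where
  add φ ψ := ⟨φ.left + ψ.left, φ.right + ψ.right, ⟨φ.hom.map + ψ.hom.map,
    by simp [φ.hom.left_comm, ψ.hom.left_comm], by simp [φ.hom.right_comm, ψ.hom.right_comm]⟩,
    by rw [add_push, add_pull, φ.ext_comm, ψ.ext_comm]⟩

instance (P Q : DistExangle s) : Neg (P ⟶ Q) where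
  neg φ := ⟨-φ.left, -φ.right, ⟨-φ.hom.map,
    by simp [φ.hom.left_comm], by simp [φ.hom.right_comm]⟩,
    by rw [neg_push, neg_pull, φ.ext_comm]⟩

@[simp] lemma zero_left (P Q : DistExangle s) : (0 : P ⟶ Q).left = 0 := rfl
@[simp] lemma zero_right (P Q : DistExangle s) : (0 : P ⟶ Q).right = 0 := rfl
@[simp] lemma zero_map (P Q : DistExangle s) : (0 : P ⟶ Q).hom.map = 0 := rfl
@[simp] lemma add_left {P Q : DistExangle s} (φ ψ : P ⟶ Q) :
    (φ + ψ).left = φ.left + ψ.left := rfl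
@[simp] lemma add_right {P Q : DistExangle s} (φ ψ : P ⟶ Q) :
    (φ + ψ).right = φ.right + ψ.right := rfl
@[simp] lemma add_map {P Q : DistExangle s} (φ ψ : P ⟶ Q) :
    (φ + ψ).hom.map = φ.hom.map + ψ.hom.map := rfl
@[simp] lemma neg_left {P Q : DistExangle s} (φ : P ⟶ Q) : (-φ).left = -φ.left := rfl
@[simp] lemma neg_right {P Q : DistExangle s} (φ : P ⟶ Q) : (-φ).right = -φ.right := rfl
@[simp] lemma neg_map {P Q : DistExangle s} (φ : P ⟶ Q) : (-φ).hom.map = -φ.hom.map := rfl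

/-- Morphisms of distinguished `n`-exangles are added componentwise. -/
instance : Preadditive (DistExangle s) where
  homGroup P Q :=
    { add_assoc := fun _ _ _ => hom_ext (add_assoc _ _ _) (add_assoc _ _ _) (add_assoc _ _ _)
      zero_add := fun _ => hom_ext (zero_add _) (zero_add _) (zero_add _)
      add_zero := fun _ => hom_ext (add_zero _) (add_zero _) (add_zero _)
      add_comm := fun _ _ => hom_ext (add_comm _ _) (add_comm _ _) (add_comm _ _)
      neg_add_cancel := fun _ =>
        hom_ext (neg_add_cancel _) (neg_add_cancel _) (neg_add_cancel _)
      nsmul := nsmulRec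
      zsmul := zsmulRec }
  add_comp _ _ _ _ _ _ := hom_ext (Preadditive.add_comp _ _ _ _ _ _)
    (Preadditive.add_comp _ _ _ _ _ _) (Preadditive.add_comp _ _ _ _ _ _)
  comp_add _ _ _ _ _ _ := hom_ext (Preadditive.comp_add _ _ _ _ _ _)
    (Preadditive.comp_add _ _ _ _ _ _) (Preadditive.comp_add _ _ _ _ _ _)

/-- The ideal `R₂` of `S(C)`: the morphisms `φ : P ⟶ Q` whose last component `φₙ₊₁` factors through
the last differential (the deflation) of `Q`. -/
def idealR₂ (P Q : DistExangle s) : AddSubgroup (P ⟶ Q) where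
  carrier := {φ | ∃ p : P.D ⟶ Q.X.cx.X n, φ.right = p ≫ Q.X.dLast}
  zero_mem' := ⟨0, by simp⟩
  add_mem' := by
    rintro φ ψ ⟨p, hp⟩ ⟨q, hq⟩
    exact ⟨p + q, by simp [hp, hq]⟩
  neg_mem' := by
    rintro φ ⟨p, hp⟩
    exact ⟨-p, by simp [hp]⟩

lemma comp_mem_idealR₂ {P Q R : DistExangle s} (φ : P ⟶ Q) {ψ : Q ⟶ R} (h : ψ ∈ idealR₂ Q R) :
    φ ≫ ψ ∈ idealR₂ P R := by
  obtain ⟨p, hp⟩ := h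
  exact ⟨φ.right ≫ p, by simp [hp]⟩

lemma mem_idealR₂_comp {P Q R : DistExangle s} {φ : P ⟶ Q} (h : φ ∈ idealR₂ P Q) (ψ : Q ⟶ R) :
    φ ≫ ψ ∈ idealR₂ P R := by
  obtain ⟨p, hp⟩ := h
  refine ⟨p ≫ ψ.hom.map.f n, ?_⟩
  have h₁ := ψ.hom.right_comm
  simp only [EndedComplex.dLast] at hp ⊢
  rw [comp_right, hp]
  simp only [Category.assoc, ← h₁, HomologicalComplex.Hom.comm_assoc]

/-- Two morphisms are identified in `S(C)/R₂` when their difference lies in `R₂`. -/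
def relR₂ (s : Correspondence E n) : HomRel (DistExangle s) :=
  fun P Q φ ψ => φ - ψ ∈ idealR₂ P Q

instance (s : Correspondence E n) : Congruence (relR₂ s) where
  comp_left {P Q R} φ ψ ψ' h := by
    simpa only [relR₂, ← Preadditive.comp_sub] using comp_mem_idealR₂ φ h
  comp_right {P Q R} φ φ' ψ h := by
    simpa only [relR₂, ← Preadditive.sub_comp] using mem_idealR₂_comp h ψ
  equivalence {P Q} :=
    { refl := fun φ => by simp only [relR₂, sub_self, zero_mem]
      symm := fun {φ ψ} h => by simpa only [relR₂, neg_sub] using neg_mem h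
      trans := fun {φ ψ χ} h h' => by
        simpa only [relR₂, sub_add_sub_cancel] using add_mem h h' }

lemma relR₂_add (s : Correspondence E n) ⦃P Q : DistExangle s⦄ (φ₁ φ₂ ψ₁ ψ₂ : P ⟶ Q)
    (h : relR₂ s φ₁ φ₂) (h' : relR₂ s ψ₁ ψ₂) : relR₂ s (φ₁ + ψ₁) (φ₂ + ψ₂) := by
  simpa only [relR₂, add_sub_add_comm] using add_mem h h'

end DistExangle

variable [E.Additive] [∀ X, (E.obj X).Additive]

/-- The ideal quotient `S(C)/R₂`. -/
abbrev ExangleQuotient (s : Correspondence E n) :=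
  CategoryTheory.Quotient (DistExangle.relR₂ s)

/-- The additive structure that `S(C)/R₂` inherits from `S(C)`. -/
instance quotientPreadditive (s : Correspondence E n) : Preadditive (ExangleQuotient s) :=
  CategoryTheory.Quotient.preadditive _ (DistExangle.relR₂_add s)

/-- The class in `S(C)/R₂` of a morphism of `S(C)`. -/
abbrev cls {s : Correspondence E n} {P Q : DistExangle s} (φ : P ⟶ Q) :
    (CategoryTheory.Quotient.functor (DistExangle.relR₂ s)).obj P ⟶
      (CategoryTheory.Quotient.functor (DistExangle.relR₂ s)).obj Q :=
  (CategoryTheory.Quotient.functor (DistExangle.relR₂ s)).map φ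

end Exangles

end NExangulated

/-! Exactness of `C(-, Xₙ) ⟶ C(-, Xₙ₊₁) ⟶ 𝔼(-, X₀)` shows that `φ : P ⟶ Q` lies in `R₂` iff
`(φₙ₊₁)^* δ' = 0`, equivalently iff `(φ₀)_* δ = 0`. Hence the class of `φ` in `S(C)/R₂` is
determined by the extension `(φ₀)_* δ = (φₙ₊₁)^* δ'` in `𝔼(P.D, Q.A)` (`cls_eq_iff`). Conversely
every compatible pair of end maps lifts to a morphism (`exists_hom`), so the computations take place
on end terms and extensions.

Let `I` realize this extension. A map `t` into `P.D` kills `(φ₀)_* δ` iff it factors through the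
last differential of `I`, which makes `(𝟙, …, I.dLast)` a kernel of `φ`; dually `(I.dFirst, …, 𝟙)`
is a cokernel (`exists_isLimit_of_realizes`, `exists_isColimit_of_realizes`). Moreover `φ` equals
`(φ₀, 𝟙) : P ⟶ I` followed by `(𝟙, φₙ₊₁) : I ⟶ Q` in the quotient. Good lifts show that the first is
a normal epimorphism and the second a normal monomorphism, hence all monomorphisms and epimorphisms
are normal. Explicit cones and cocones matter only for these normality statements and for the
components of the prescribed kernel and cokernel. -/

namespace NExangulated

/-! ### Additivity of pushforward and pullback in the extension -/

section Extensions

variable {C : Type u} [Category.{v} C] {E : Cᵒᵖ ⥤ C ⥤ AddCommGrpCat.{w}}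

lemma push_add {A A' D : C} (a : A ⟶ A') (δ ρ : Extn E D A) :
    push a (δ + ρ) = push a δ + push a ρ :=
  map_add _ _ _

lemma pull_add {A D D' : C} (c : D' ⟶ D) (δ ρ : Extn E D A) :
    pull c (δ + ρ) = pull c δ + pull c ρ :=
  map_add _ _ _

@[simp]
lemma push_zero {A A' D : C} (a : A ⟶ A') : push a (0 : Extn E D A) = 0 :=
  map_zero _

@[simp]
lemma pull_zero {A D D' : C} (c : D' ⟶ D) : pull c (0 : Extn E D A) = 0 :=
  map_zero _

end Extensions

/-! ### Mapping cocones and cones with their structure morphisms -/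

section Cones

variable {C : Type u} [Category.{v} C] [Preadditive C] {n : ℕ}

lemma EndedComplex.comp_dLast {A D : C} (X : EndedComplex n A D) (i : ℕ) (h : i + 1 = n) :
    X.cx.d i n ≫ X.dLast = 0 := by
  subst h
  simp [dLast]

lemma EndedComplex.dFirst_comp {A D : C} (X : EndedComplex n A D) :
    X.dFirst ≫ X.cx.d 1 2 = 0 := by
  simp [dFirst]

lemma EndedComplex.Hom.comp_dLast {A D A' D' : C} {X : EndedComplex n A D}
    {Y : EndedComplex n A' D'} {a : A ⟶ A'} {c : D ⟶ D'} (f : X.Hom Y a c) :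
    f.map.f n ≫ Y.dLast = X.dLast ≫ c := by
  simp only [dLast, Category.assoc, ← f.right_comm, HomologicalComplex.Hom.comm_assoc]

lemma EndedComplex.Hom.dFirst_comp {A D A' D' : C} {X : EndedComplex n A D}
    {Y : EndedComplex n A' D'} {a : A ⟶ A'} {c : D ⟶ D'} (f : X.Hom Y a c) :
    X.dFirst ≫ f.map.f 1 = a ≫ Y.dFirst := by
  simp only [dFirst, Category.assoc, ← f.map.comm, reassoc_of% f.left_comm]

namespace MappingCocone

variable {A B D : C} {X : EndedComplex n A D} {Y : EndedComplex n B D} {a : A ⟶ B}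
  {h : X.Hom Y a (𝟙 D)} {N : EndedComplex n A (Y.cx.X n)}

lemma dFirst_eq (hc : MappingCocone h N) :
    N.dFirst = X.dFirst ≫ hc.inl 1 + a ≫ Y.left.hom ≫ hc.inr 0 := by
  have h₀ := hc.inl_fst 0 n.zero_le
  simp only [EndedComplex.dFirst, hc.left_eq, hc.d_zero, Preadditive.comp_add, Category.assoc,
    reassoc_of% h₀, reassoc_of% h.left_comm]

/-- The components of the projection from the mapping cocone of `X ⟶ Y` to `X`. -/
def projApp (hc : MappingCocone h N) (i : ℕ) : N.cx.X i ⟶ X.cx.X i :=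
  -- In degree `n + 1` the cocone is `Yₙ` and `fst` vanishes, so the component there has to be
  -- `Y.dLast`, transported along the end identifications.
  if hi : i = n + 1 then
    eqToHom (by rw [hi]) ≫ N.right.hom ≫ Y.dLast ≫ X.right.inv ≫ eqToHom (by rw [hi])
  else hc.fst i

lemma projApp_of_le (hc : MappingCocone h N) {i : ℕ} (hi : i ≤ n) :
    hc.projApp i = hc.fst i :=
  dif_neg (by omega)

lemma projApp_last (hc : MappingCocone h N) :
    hc.projApp (n + 1) = N.right.hom ≫ Y.dLast ≫ X.right.inv := by
  simp [projApp]

lemma projApp_comm (hc : MappingCocone h N) (hn : 0 < n) (i : ℕ) :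
    hc.projApp i ≫ X.cx.d i (i + 1) = N.cx.d i (i + 1) ≫ hc.projApp (i + 1) := by
  rcases lt_trichotomy i n with hi | rfl | hi
  · rw [hc.projApp_of_le hi.le, hc.projApp_of_le hi]
    obtain _ | i := i
    · simp [hc.d_zero, hc.inl_fst 1 hi, hc.inr_fst 0 n.zero_le]
    · simp [hc.d_succ i hi.le, hc.inl_fst (i + 2) hi, hc.inr_fst (i + 1) hi.le]
  -- Positivity of `n` puts the last differential `(hₙ, -d)` under `d_succ`. Composed with
  -- `Y.dLast`, its second entry dies and its first becomes the last differential of `X`, because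
  -- `hₙ₊₁ = 𝟙`.
  · obtain ⟨i, rfl⟩ : ∃ j, i = j + 1 := ⟨i - 1, by omega⟩
    have h₁ := hc.inr_snd (i + 1) le_rfl
    have h₂ := h.comp_dLast
    have h₃ := Y.comp_dLast i rfl
    rw [hc.projApp_of_le le_rfl, hc.projApp_last, hc.d_succ i le_rfl, hc.right_eq, hc.inl_last]
    simp only [comp_zero, zero_add, Preadditive.sub_comp, Category.assoc, reassoc_of% h₁,
      reassoc_of% h₂, reassoc_of% h₃]
    simp [EndedComplex.dLast]
  · exact (X.isZero (i + 1) (by omega)).eq_of_tgt _ _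

/-- The projection from the mapping cocone of `X ⟶ Y` to `X`. -/
def proj (hc : MappingCocone h N) (hn : 0 < n) : N.Hom X (𝟙 A) Y.dLast where
  map :=
    { f := hc.projApp
      comm' := by
        rintro i _ rfl
        exact hc.projApp_comm hn i }
  left_comm := by
    have h₁ := hc.projApp_of_le n.zero_le
    have h₂ := hc.inl_fst 0 n.zero_le
    simp [h₁, h₂, hc.left_eq]
  right_comm := by simp [hc.projApp_last]

end MappingCocone

namespace MappingCone

variable {A D D' : C} {X : EndedComplex n A D} {Y : EndedComplex n A D'} {c : D ⟶ D'}
  {f : X.Hom Y (𝟙 A) c} {M : EndedComplex n (X.cx.X 1) D'}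

lemma dLast_eq (hc : MappingCone f M) :
    M.dLast = hc.fst n ≫ X.right.hom ≫ c + hc.snd n ≫ Y.dLast := by
  have h₁ := hc.inr_snd (n + 1) (by omega)
  have h₂ : X.cx.d (n + 1) (n + 2) = 0 := (X.isZero (n + 2) (by omega)).eq_of_tgt _ _
  simp only [EndedComplex.dLast, hc.right_eq, hc.d_eq, h₂, zero_comp, comp_zero, neg_zero,
    zero_add, Preadditive.add_comp, Category.assoc, reassoc_of% h₁, f.right_comm]

/-- The components of the inclusion of `Y` in the mapping cone of `X ⟶ Y`. -/
def inclApp (hc : MappingCone f M) : ∀ i : ℕ, Y.cx.X i ⟶ M.cx.X i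
  -- The cone starts with `X₁` alone and `inr 0 = 0`, so the component in degree `0` is the first
  -- differential of `X`.
  | 0 => Y.left.inv ≫ X.dFirst ≫ M.left.hom
  | i + 1 => hc.inr (i + 1)

lemma inclApp_comm (hc : MappingCone f M) (i : ℕ) :
    hc.inclApp i ≫ M.cx.d i (i + 1) = Y.cx.d i (i + 1) ≫ hc.inclApp (i + 1) := by
  obtain _ | i := i
  · have h₁ := hc.inl_fst 0
    have h₂ := hc.inl_snd 0
    have h₃ := X.dFirst_comp
    have h₄ := f.dFirst_comp
    simp only [inclApp, Category.assoc, hc.left_eq, hc.d_eq, Preadditive.comp_add,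
      Preadditive.comp_neg, reassoc_of% h₁, reassoc_of% h₂, reassoc_of% h₃, reassoc_of% h₄,
      zero_comp, comp_zero, neg_zero, zero_add, add_zero]
    simp [EndedComplex.dFirst]
  · have h₁ := hc.inr_snd (i + 1) (by omega)
    have h₂ := hc.inr_fst (i + 1)
    simp [inclApp, hc.d_eq, reassoc_of% h₁, reassoc_of% h₂]

/-- The inclusion of `Y` in the mapping cone of `X ⟶ Y`. -/
def incl (hc : MappingCone f M) : Y.Hom M X.dFirst (𝟙 D') where
  map :=
    { f := hc.inclApp
      comm' := by
        rintro i _ rfl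
        exact hc.inclApp_comm i }
  left_comm := by simp [inclApp]
  right_comm := by
    have h₁ := hc.inr_snd (n + 1) (by omega)
    simp [inclApp, hc.right_eq, reassoc_of% h₁]

end MappingCone

end Cones

/-! ### Morphisms of the quotient as extensions -/

section Quotient

variable {C : Type u} [Category.{v} C] [Preadditive C]
  {E : Cᵒᵖ ⥤ C ⥤ AddCommGrpCat.{w}} {n : ℕ} {s : Correspondence E n}

lemma exists_realizes (s : Correspondence E n) {A D : C} (δ : Extn E D A) :
    ∃ X : EndedComplex n A D, Realizes s X δ := by
  obtain ⟨X, hX⟩ := Quotient.exists_rep (s A D δ)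
  exact ⟨X, hX.symm⟩

lemma IsExactRealization.exists_hom (hs : IsExactRealization s) {P Q : DistExangle s}
    (a : P.A ⟶ Q.A) (c : P.D ⟶ Q.D) (h : push a P.δ = pull c Q.δ) :
    ∃ φ : P ⟶ Q, φ.left = a ∧ φ.right = c := by
  obtain ⟨f⟩ := hs.exists_lift P.δ Q.δ a c h P.X Q.X P.realizes Q.realizes
  exact ⟨⟨a, c, f, h⟩, rfl, rfl⟩

variable [E.Additive] [∀ X, (E.obj X).Additive]

/-- Exactness at `C(-, Xₙ₊₁)` turns factoring through the deflation of `Q` into vanishing of the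
pullback, which is also the pushforward. This makes the one-sided definition of `R₂` self-dual. -/
lemma IsExactRealization.mem_idealR₂_iff (hs : IsExactRealization s) {P Q : DistExangle s}
    (φ : P ⟶ Q) : φ ∈ DistExangle.idealR₂ P Q ↔ push φ.left P.δ = 0 := by
  rw [φ.ext_comm]
  refine Iff.trans ?_ ((hs.isNExangle Q.δ Q.X Q.realizes).exact_yoneda_last P.D φ.right).symm
  exact ⟨fun ⟨p, hp⟩ => ⟨p, hp.symm⟩, fun ⟨p, hp⟩ => ⟨p, hp.symm⟩⟩

lemma cls_comp {P Q R : DistExangle s} (φ : P ⟶ Q) (ψ : Q ⟶ R) :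
    cls (φ ≫ ψ) = cls φ ≫ cls ψ :=
  Functor.map_comp _ _ _

lemma cls_id (P : DistExangle s) : cls (𝟙 P) = 𝟙 _ :=
  CategoryTheory.Functor.map_id _ _

lemma cls_surjective {P Q : DistExangle s}
    (f : (CategoryTheory.Quotient.functor (DistExangle.relR₂ s)).obj P ⟶
      (CategoryTheory.Quotient.functor (DistExangle.relR₂ s)).obj Q) :
    ∃ φ : P ⟶ Q, cls φ = f :=
  Functor.map_surjective _ f

lemma IsExactRealization.cls_eq_iff (hs : IsExactRealization s) {P Q : DistExangle s}
    (φ ψ : P ⟶ Q) : cls φ = cls ψ ↔ push φ.left P.δ = push ψ.left P.δ := by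
  have h : (φ - ψ).left = φ.left + -ψ.left := by
    rw [sub_eq_add_neg, DistExangle.add_left, DistExangle.neg_left]
  rw [CategoryTheory.Quotient.functor_map_eq_iff, DistExangle.relR₂, hs.mem_idealR₂_iff, h,
    add_push, neg_push, ← sub_eq_add_neg, sub_eq_zero]

lemma IsExactRealization.cls_eq_iff' (hs : IsExactRealization s) {P Q : DistExangle s}
    (φ ψ : P ⟶ Q) : cls φ = cls ψ ↔ pull φ.right Q.δ = pull ψ.right Q.δ := by
  rw [hs.cls_eq_iff, φ.ext_comm, ψ.ext_comm]

lemma IsExactRealization.cls_eq_zero_iff (hs : IsExactRealization s) {P Q : DistExangle s}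
    (φ : P ⟶ Q) : cls φ = 0 ↔ push φ.left P.δ = 0 := by
  have h := hs.cls_eq_iff φ 0
  rwa [DistExangle.zero_left, zero_push] at h

/-- Composing with `φ` pushes the extension of a class forward along `φ.left`, which is injective
when `φ.left` is invertible. -/
lemma IsExactRealization.mono_cls (hs : IsExactRealization s) {P Q : DistExangle s} (φ : P ⟶ Q)
    [IsIso φ.left] : Mono (cls φ) := by
  refine Preadditive.mono_of_cancel_zero _ ?_
  rintro ⟨T⟩ g hg
  obtain ⟨ψ, rfl⟩ := cls_surjective g
  rw [← cls_comp, hs.cls_eq_zero_iff, DistExangle.comp_left, push_comp] at hg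
  rw [hs.cls_eq_zero_iff, ← push_id (push ψ.left T.δ), ← IsIso.hom_inv_id φ.left, push_comp, hg,
    push_zero]

lemma IsExactRealization.epi_cls (hs : IsExactRealization s) {P Q : DistExangle s} (φ : P ⟶ Q)
    [IsIso φ.right] : Epi (cls φ) := by
  refine Preadditive.epi_of_cancel_zero _ ?_
  rintro ⟨T⟩ g hg
  obtain ⟨ψ, rfl⟩ := cls_surjective g
  rw [← cls_comp, hs.cls_eq_zero_iff, DistExangle.Hom.ext_comm, DistExangle.comp_right, pull_comp] at hg
  rw [hs.cls_eq_zero_iff, DistExangle.Hom.ext_comm, ← pull_id (pull ψ.right T.δ),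
    ← IsIso.inv_hom_id φ.right, pull_comp, hg, pull_zero]

/-! ### Kernels and cokernels -/

/-- A morphism `k` whose left component is invertible is a kernel of `φ` if the pullbacks of the
extension along the maps killing the class of `φ` are those along the maps factoring
through `k`. -/
lemma IsExactRealization.exists_isLimit (hs : IsExactRealization s) {K P Q : DistExangle s}
    (k : K ⟶ P) [IsIso k.left] (φ : P ⟶ Q)
    (h : ∀ {T : C} (t : T ⟶ P.D), pull t (push φ.left P.δ) = 0 ↔
      ∃ g : T ⟶ K.D, pull t P.δ = pull (g ≫ k.right) P.δ) :
    ∃ w : cls k ≫ cls φ = 0, Nonempty (IsLimit (KernelFork.ofι (cls k) w)) := by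
  have := hs.mono_cls k
  have w : cls k ≫ cls φ = 0 := by
    rw [← cls_comp, hs.cls_eq_zero_iff, DistExangle.comp_left, push_comp, k.ext_comm, push_pull]
    exact (h k.right).2 ⟨𝟙 _, by rw [Category.id_comp]⟩
  -- Uniqueness of lifts is already contained in `cls k` being a monomorphism; only existence
  -- remains.
  refine ⟨w, ⟨KernelFork.IsLimit.ofι' _ _ fun {A} f hf => Classical.indefiniteDescription _ ?_⟩⟩
  obtain ⟨T⟩ := A
  obtain ⟨ψ, rfl⟩ := cls_surjective f
  rw [← cls_comp, hs.cls_eq_zero_iff, DistExangle.comp_left, push_comp, ψ.ext_comm,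
    push_pull, h] at hf
  obtain ⟨g, hg⟩ := hf
  -- The left end is forced by `χ ≫ k` having left component `ψ.left`. The right end `g` need only
  -- satisfy `ψ.right^* δ = (g ≫ k.right)^* δ`, since classes see only extensions.
  obtain ⟨χ, hχ, -⟩ := hs.exists_hom (P := T) (Q := K) (ψ.left ≫ inv k.left) g (by
    rw [push_comp, ψ.ext_comm, hg, pull_comp, ← k.ext_comm, push_pull, ← push_comp,
      IsIso.hom_inv_id, push_id])
  refine ⟨cls χ, ?_⟩
  rw [← cls_comp, hs.cls_eq_iff, DistExangle.comp_left, hχ, Category.assoc, IsIso.inv_hom_id,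
    Category.comp_id]

/-- A morphism `c` whose right component is invertible is a cokernel of `φ` if the pushouts of
the extension along the maps killing the class of `φ` are those along the maps factoring
through `c`. -/
lemma IsExactRealization.exists_isColimit (hs : IsExactRealization s) {P Q R : DistExangle s}
    (c : Q ⟶ R) [IsIso c.right] (φ : P ⟶ Q)
    (h : ∀ {T : C} (t : Q.A ⟶ T), push t (pull φ.right Q.δ) = 0 ↔
      ∃ g : R.A ⟶ T, push t Q.δ = push (c.left ≫ g) Q.δ) :
    ∃ w : cls φ ≫ cls c = 0, Nonempty (IsColimit (CokernelCofork.ofπ (cls c) w)) := by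
  have := hs.epi_cls c
  have w : cls φ ≫ cls c = 0 := by
    rw [← cls_comp, hs.cls_eq_zero_iff, DistExangle.Hom.ext_comm, DistExangle.comp_right, pull_comp,
      ← c.ext_comm, ← push_pull]
    exact (h c.left).2 ⟨𝟙 _, by rw [Category.comp_id]⟩
  refine ⟨w, ⟨CokernelCofork.IsColimit.ofπ' _ _
    fun {A} f hf => Classical.indefiniteDescription _ ?_⟩⟩
  obtain ⟨T⟩ := A
  obtain ⟨ψ, rfl⟩ := cls_surjective f
  rw [← cls_comp, hs.cls_eq_zero_iff, DistExangle.Hom.ext_comm, DistExangle.comp_right, pull_comp,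
    ← ψ.ext_comm, ← push_pull, h] at hf
  obtain ⟨g, hg⟩ := hf
  obtain ⟨χ, -, hχ⟩ := hs.exists_hom (P := R) (Q := T) g (inv c.right ≫ ψ.right) (by
    rw [pull_comp, ← ψ.ext_comm, hg, push_comp, c.ext_comm, push_pull, ← pull_comp,
      IsIso.inv_hom_id, pull_id])
  refine ⟨cls χ, ?_⟩
  rw [← cls_comp, hs.cls_eq_iff', DistExangle.comp_right, hχ, IsIso.hom_inv_id_assoc]

/-- If `I` realizes `(φ₀)_* δ`, then `(𝟙, …, dₙ)` is a kernel of `φ`. -/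
lemma IsExactRealization.exists_isLimit_of_realizes (hs : IsExactRealization s)
    {K P Q : DistExangle s} (φ : P ⟶ Q) {I : EndedComplex n Q.A P.D}
    (hI : Realizes s I (push φ.left P.δ)) (k : K ⟶ P) [IsIso k.left] (e : K.D ≅ I.cx.X n)
    (hk : k.right = e.hom ≫ I.dLast) :
    ∃ w : cls k ≫ cls φ = 0, Nonempty (IsLimit (KernelFork.ofι (cls k) w)) := by
  have hX := hs.isNExangle _ _ hI
  refine hs.exists_isLimit k φ fun {T} t => ⟨fun ht => ?_, fun ⟨g, hg⟩ => ?_⟩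
  · obtain ⟨g, rfl⟩ := (hX.exact_yoneda_last T t).1 ht
    exact ⟨g ≫ e.inv, by simp [hk]⟩
  · rw [← push_pull, hg, push_pull, hk, ← Category.assoc, pull_comp, hX.pull_dLast, pull_zero]

/-- If `I` realizes `(φₙ₊₁)^* δ'`, then `(d₀, …, 𝟙)` is a cokernel of `φ`. -/
lemma IsExactRealization.exists_isColimit_of_realizes (hs : IsExactRealization s)
    {P Q R : DistExangle s} (φ : P ⟶ Q) {I : EndedComplex n Q.A P.D}
    (hI : Realizes s I (pull φ.right Q.δ)) (c : Q ⟶ R) [IsIso c.right] (e : I.cx.X 1 ≅ R.A)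
    (hc : c.left = I.dFirst ≫ e.hom) :
    ∃ w : cls φ ≫ cls c = 0, Nonempty (IsColimit (CokernelCofork.ofπ (cls c) w)) := by
  have hX := hs.isNExangle _ _ hI
  refine hs.exists_isColimit c φ fun {T} t => ⟨fun ht => ?_, fun ⟨g, hg⟩ => ?_⟩
  · obtain ⟨g, rfl⟩ := (hX.exact_coyoneda_first T t).1 ht
    exact ⟨e.inv ≫ g, by simp [hc]⟩
  · rw [push_pull, hg, ← push_pull, hc, Category.assoc, push_comp, hX.push_dFirst, push_zero]

lemma IsExactRealization.hasKernels (hs : IsExactRealization s) :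
    HasKernels (ExangleQuotient s) where
  has_limit {X Y} f := by
    obtain ⟨P⟩ := X
    obtain ⟨Q⟩ := Y
    obtain ⟨φ, rfl⟩ := cls_surjective f
    obtain ⟨I, hI⟩ := exists_realizes s (push φ.left P.δ)
    obtain ⟨N, hN⟩ := exists_realizes s (pull I.dLast P.δ)
    obtain ⟨k, h₁, h₂⟩ := hs.exists_hom (P := ⟨_, _, N, _, hN⟩) (Q := P) (𝟙 _) I.dLast
      (push_id _)
    have : IsIso k.left := by rw [h₁]; infer_instance
    obtain ⟨w, ⟨h⟩⟩ := hs.exists_isLimit_of_realizes φ hI k (Iso.refl _) (by simp [h₂])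
    exact ⟨⟨⟨_, h⟩⟩⟩

lemma IsExactRealization.hasCokernels (hs : IsExactRealization s) :
    HasCokernels (ExangleQuotient s) where
  has_colimit {X Y} f := by
    obtain ⟨P⟩ := X
    obtain ⟨Q⟩ := Y
    obtain ⟨φ, rfl⟩ := cls_surjective f
    obtain ⟨I, hI⟩ := exists_realizes s (pull φ.right Q.δ)
    obtain ⟨M, hM⟩ := exists_realizes s (push I.dFirst Q.δ)
    obtain ⟨c, h₁, h₂⟩ := hs.exists_hom (P := Q) (Q := ⟨_, _, M, _, hM⟩) I.dFirst (𝟙 _)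
      (pull_id _).symm
    have : IsIso c.right := by rw [h₂]; infer_instance
    obtain ⟨w, ⟨h⟩⟩ := hs.exists_isColimit_of_realizes φ hI c (Iso.refl _) (by simp [h₁])
    exact ⟨⟨⟨_, h⟩⟩⟩

/-! ### Normality of monomorphisms and epimorphisms -/

/-- The canonical morphism `(𝟙, c) : c^* δ ⟶ δ` is a normal monomorphism. -/
lemma IsNExangulated.exists_normalMono (hs : IsNExangulated s) (Q : DistExangle s) {D : C}
    (c : D ⟶ Q.D) {X : EndedComplex n Q.A D} {δ : Extn E D Q.A} (hX : Realizes s X δ)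
    (hδ : δ = pull c Q.δ) :
    ∃ ι : (⟨Q.A, D, X, δ, hX⟩ : DistExangle s) ⟶ Q, ι.left = 𝟙 Q.A ∧ ι.right = c ∧
      Nonempty (NormalMono (cls ι)) := by
  subst hδ
  obtain ⟨f, M, ⟨hc⟩, hM⟩ := hs.exists_good_lift Q.δ c X Q.X hX Q.realizes
  -- The map to the cone of the good lift is the one whose kernel will be `ι`.
  obtain ⟨r, hr, -⟩ := hs.exists_hom (P := Q) (Q := ⟨_, _, M, _, hM⟩) X.dFirst (𝟙 _)
    (pull_id _).symm
  let ι : (⟨Q.A, D, X, _, hX⟩ : DistExangle s) ⟶ Q := ⟨𝟙 _, c, f, push_id _⟩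
  have : IsIso ι.left := inferInstanceAs (IsIso (𝟙 _))
  obtain ⟨w, ⟨h⟩⟩ := hs.exists_isLimit ι r fun {T} t => by
    rw [hr]
    refine ⟨fun ht => ?_, fun ⟨g, hg⟩ => ?_⟩
    · obtain ⟨g, rfl⟩ := ((hs.isNExangle _ _ hM).exact_yoneda_last T t).1 ht
      -- The last differential of the cone is `(c, Q.X.dLast)`. Its second entry pulls `Q.δ` back to
      -- zero, so `t` and its part through `c` have the same pullback although the maps may differ.
      refine ⟨g ≫ hc.fst n ≫ X.right.hom, ?_⟩
      have hQ := (hs.isNExangle _ _ Q.realizes).pull_dLast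
      simp only [hc.dLast_eq, pull_comp, add_pull, hQ, pull_zero, add_zero, ι]
    · rw [← push_pull, hg, pull_comp, push_pull]
      exact (congrArg (pull g) (hs.isNExangle _ _ hX).push_dFirst).trans (pull_zero g)
  exact ⟨ι, rfl, rfl, ⟨⟨_, cls r, w, h⟩⟩⟩

/-- The canonical morphism `(a, 𝟙) : δ ⟶ a_* δ` is a normal epimorphism. -/
lemma IsNExangulated.exists_normalEpi (hs : IsNExangulated s) (P : DistExangle s)
    {B : C} (a : P.A ⟶ B) {X : EndedComplex n B P.D} {δ : Extn E P.D B} (hX : Realizes s X δ)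
    (hδ : δ = push a P.δ) :
    ∃ π : P ⟶ (⟨B, P.D, X, δ, hX⟩ : DistExangle s), π.left = a ∧ π.right = 𝟙 P.D ∧
      Nonempty (NormalEpi (cls π)) := by
  subst hδ
  obtain ⟨f, N, ⟨hc⟩, hN⟩ := hs.exists_good_lift_op P.δ a P.X X P.realizes hX
  obtain ⟨r, -, hr⟩ := hs.exists_hom (P := ⟨_, _, N, _, hN⟩) (Q := P) (𝟙 _) X.dLast
    (push_id _)
  let π : P ⟶ (⟨B, P.D, X, _, hX⟩ : DistExangle s) := ⟨a, 𝟙 _, f, (pull_id _).symm⟩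
  have : IsIso π.right := inferInstanceAs (IsIso (𝟙 _))
  obtain ⟨w, ⟨h⟩⟩ := hs.exists_isColimit π r fun {T} t => by
    rw [hr]
    refine ⟨fun ht => ?_, fun ⟨g, hg⟩ => ?_⟩
    · obtain ⟨g, rfl⟩ := ((hs.isNExangle _ _ hN).exact_coyoneda_first T t).1 ht
      -- Dually, the first differential of the cocone is `(P.X.dFirst, a)`, and its first entry
      -- pushes `P.δ` to zero.
      refine ⟨X.left.hom ≫ hc.inr 0 ≫ g, ?_⟩
      have hP := (hs.isNExangle _ _ P.realizes).push_dFirst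
      simp only [hc.dFirst_eq, push_comp, add_push, hP, push_zero, zero_add, π]
    · rw [push_pull, hg, push_comp, ← push_pull]
      exact (congrArg (push g) (hs.isNExangle _ _ hX).pull_dLast).trans (push_zero g)
  exact ⟨π, rfl, rfl, ⟨⟨_, cls r, w, h⟩⟩⟩

/-- Every morphism of `S(C)/R₂` is a normal epimorphism followed by a normal monomorphism. -/
lemma IsNExangulated.exists_factorization (hs : IsNExangulated s)
    {X Y : ExangleQuotient s} (f : X ⟶ Y) :
    ∃ (Z : ExangleQuotient s) (p : X ⟶ Z) (i : Z ⟶ Y), p ≫ i = f ∧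
      Nonempty (NormalEpi p) ∧ Nonempty (NormalMono i) := by
  obtain ⟨P⟩ := X
  obtain ⟨Q⟩ := Y
  obtain ⟨φ, rfl⟩ := cls_surjective f
  obtain ⟨I, hI⟩ := exists_realizes s (push φ.left P.δ)
  obtain ⟨π, h₁, -, hπ⟩ := hs.exists_normalEpi P φ.left hI rfl
  -- The same exangle `I` serves as target of `π` and source of `ι`, its extension being both a
  -- pushforward and a pullback.
  obtain ⟨ι, h₂, -, hι⟩ := hs.exists_normalMono Q φ.right hI φ.ext_comm
  refine ⟨_, cls π, cls ι, ?_, hπ, hι⟩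
  rw [← cls_comp, hs.cls_eq_iff, DistExangle.comp_left, h₁, h₂, Category.comp_id]

lemma IsNExangulated.isNormalMonoCategory (hs : IsNExangulated s) :
    IsNormalMonoCategory (ExangleQuotient s) where
  normalMonoOfMono {X Y} f _ := by
    obtain ⟨Z, p, i, rfl, ⟨hp⟩, ⟨hi⟩⟩ := hs.exists_factorization f
    have : Mono p := mono_of_mono p i
    -- `p` is the cokernel of a map it annihilates; as `p` is mono that map is zero, so `p` is
    -- invertible and `f` is isomorphic to `i`.
    have : IsIso p := CokernelCofork.IsColimit.isIso_π _ hp.isColimit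
      (by rw [← cancel_mono p, hp.w, zero_comp])
    exact ⟨hi.ofArrowIso (Arrow.isoMk (asIso p).symm (Iso.refl _) (by simp))⟩

lemma IsNExangulated.isNormalEpiCategory (hs : IsNExangulated s) :
    IsNormalEpiCategory (ExangleQuotient s) where
  normalEpiOfEpi {X Y} f _ := by
    obtain ⟨Z, p, i, rfl, ⟨hp⟩, ⟨hi⟩⟩ := hs.exists_factorization f
    have : Epi i := epi_of_epi p i
    have : IsIso i := KernelFork.IsLimit.isIso_ι _ hi.isLimit
      (by rw [← cancel_epi i, hi.w, comp_zero])
    exact ⟨hp.ofArrowIso (Arrow.isoMk (Iso.refl _) (asIso i) (by simp))⟩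

/-! ### Zero object, biproducts and the abelian structure -/

lemma IsExactRealization.hasZeroObject [HasZeroObject C] (hs : IsExactRealization s) :
    HasZeroObject (ExangleQuotient s) := by
  obtain ⟨Z, hZ⟩ := HasZeroObject.zero (C := C)
  obtain ⟨X, hX⟩ := exists_realizes s (0 : Extn E Z Z)
  let O : DistExangle s := ⟨Z, Z, X, 0, hX⟩
  refine ⟨(CategoryTheory.Quotient.functor _).obj O, (IsZero.iff_id_eq_zero _).2 ?_⟩
  rw [← cls_id, hs.cls_eq_zero_iff]
  exact push_zero _

/-- Any realization of the direct sum of the two extensions works: projections and inclusions of the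
end terms lift, and the biproduct identities are checked on left components. -/
lemma IsExactRealization.hasBinaryBiproducts [HasBinaryBiproducts C]
    (hs : IsExactRealization s) : HasBinaryBiproducts (ExangleQuotient s) where
  has_binary_biproduct := by
    rintro ⟨P⟩ ⟨Q⟩
    let η : Extn E (P.D ⊞ Q.D) (P.A ⊞ Q.A) :=
      push biprod.inl (pull biprod.fst P.δ) + push biprod.inr (pull biprod.snd Q.δ)
    obtain ⟨X, hX⟩ := exists_realizes s η
    let B : DistExangle s := ⟨_, _, X, η, hX⟩
    obtain ⟨p, hp, -⟩ := hs.exists_hom (P := B) (Q := P) biprod.fst biprod.fst (by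
      simp [B, η, push_add, ← push_comp, push_id, zero_push])
    obtain ⟨q, hq, -⟩ := hs.exists_hom (P := B) (Q := Q) biprod.snd biprod.snd (by
      simp [B, η, push_add, ← push_comp, push_id, zero_push])
    obtain ⟨i, hi, -⟩ := hs.exists_hom (P := P) (Q := B) biprod.inl biprod.inl (by
      simp [B, η, pull_add, ← push_pull, ← pull_comp, pull_id, zero_pull])
    obtain ⟨j, hj, -⟩ := hs.exists_hom (P := Q) (Q := B) biprod.inr biprod.inr (by
      simp [B, η, pull_add, ← push_pull, ← pull_comp, pull_id, zero_pull])
    refine hasBinaryBiproduct_of_total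
      { pt := (CategoryTheory.Quotient.functor _).obj B
        fst := cls p
        snd := cls q
        inl := cls i
        inr := cls j
        inl_fst := ?_
        inl_snd := ?_
        inr_fst := ?_
        inr_snd := ?_ } ?_
    · refine (cls_comp i p).symm.trans (((hs.cls_eq_iff _ _).2 ?_).trans (cls_id P))
      rw [DistExangle.comp_left, hi, hp, biprod.inl_fst]
      rfl
    · refine (cls_comp i q).symm.trans ((hs.cls_eq_zero_iff _).2 ?_)
      rw [DistExangle.comp_left, hi, hq, biprod.inl_snd, zero_push]
    · refine (cls_comp j p).symm.trans ((hs.cls_eq_zero_iff _).2 ?_)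
      rw [DistExangle.comp_left, hj, hp, biprod.inr_fst, zero_push]
    · refine (cls_comp j q).symm.trans (((hs.cls_eq_iff _ _).2 ?_).trans (cls_id Q))
      rw [DistExangle.comp_left, hj, hq, biprod.inr_snd]
      rfl
    · refine Eq.trans (b := cls (p ≫ i + q ≫ j)) ?_
        (((hs.cls_eq_iff _ _).2 ?_).trans (cls_id B))
      · exact (congrArg₂ (· + ·) (cls_comp p i) (cls_comp q j)).symm
      · rw [DistExangle.add_left, DistExangle.comp_left, DistExangle.comp_left, hp, hq, hi, hj,
          biprod.total]
        rfl

/-- The quotient `S(C)/R₂` of an `n`-exangulated category is abelian. -/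
lemma IsNExangulated.exists_abelian [HasFiniteBiproducts C] (hs : IsNExangulated s) :
    ∃ h : Abelian (ExangleQuotient s), h.toPreadditive = quotientPreadditive s := by
  have := hasBinaryBiproducts_of_finite_biproducts C
  have := hs.hasZeroObject
  have := hs.hasBinaryBiproducts
  have := hasFiniteProducts_of_has_binary_and_terminal (C := ExangleQuotient s)
  have h₁ := hs.isNormalMonoCategory
  have h₂ := hs.isNormalEpiCategory
  -- Building the structure on the inherited addition makes the required equality definitional.
  exact ⟨{ toPreadditive := quotientPreadditive s
           normalMonoOfMono := h₁.normalMonoOfMono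
           normalEpiOfEpi := h₂.normalEpiOfEpi
           has_finite_products := inferInstance
           has_kernels := hs.hasKernels
           has_cokernels := hs.hasCokernels }, rfl⟩

end Quotient

end NExangulated

open NExangulated in
theorem theorem4p4 {C : Type u} [Category.{v} C] [Preadditive C] [HasFiniteBiproducts C]
    (E : Cᵒᵖ ⥤ C ⥤ AddCommGrpCat.{w}) [E.Additive] [∀ X, (E.obj X).Additive]
    (n : ℕ) (hn : 0 < n) (heven : Even n)
    (s : Correspondence E n) (hs : IsNExangulated s) :
    (∃ h : Abelian (ExangleQuotient s), h.toPreadditive = quotientPreadditive s) ∧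
    (∀ {P Q : DistExangle s} (φ : P ⟶ Q) (I : EndedComplex n Q.A P.D)
      (_ : Realizes s I (push φ.left P.δ)),
      -- the cocone `K(φ)` of every good lift `π : P ⟶ I` of `(φ₀, 𝟙)` is a kernel of `φ`
      (∀ (π : P.X.Hom I φ.left (𝟙 P.D)) (N : EndedComplex n P.A (I.cx.X n))
        (hc : MappingCocone π N) (hN : Realizes s N (pull I.dLast P.δ)),
        ∃ k : (⟨P.A, I.cx.X n, N, pull I.dLast P.δ, hN⟩ : DistExangle s) ⟶ P,
          k.left = 𝟙 P.A ∧ k.right = I.dLast ∧ (∀ i ≤ n, k.hom.map.f i = hc.fst i) ∧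
          ∃ w : cls k ≫ cls φ = 0, Nonempty (IsLimit (KernelFork.ofι (cls k) w))) ∧
      -- the cone `C(φ)` of every good lift `ι : I ⟶ Q` of `(𝟙, φₙ₊₁)` is a cokernel of `φ`
      (∀ (ι : I.Hom Q.X (𝟙 Q.A) φ.right) (M : EndedComplex n (I.cx.X 1) Q.D)
        (hc : MappingCone ι M) (hM : Realizes s M (push I.dFirst Q.δ)),
        ∃ c : Q ⟶ (⟨I.cx.X 1, Q.D, M, push I.dFirst Q.δ, hM⟩ : DistExangle s),
          c.left = I.dFirst ∧ c.right = 𝟙 Q.D ∧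
          (∀ i, 1 ≤ i → i ≤ n + 1 → c.hom.map.f i = hc.inr i) ∧
          ∃ w : cls φ ≫ cls c = 0, Nonempty (IsColimit (CokernelCofork.ofπ (cls c) w)))) := by
  refine ⟨hs.exists_abelian, fun {P Q} φ I hI => ⟨fun π N hc hN => ?_, fun ι M hc hM => ?_⟩⟩
  · let k : (⟨P.A, I.cx.X n, N, pull I.dLast P.δ, hN⟩ : DistExangle s) ⟶ P :=
      ⟨𝟙 _, I.dLast, hc.proj hn, push_id _⟩
    have : IsIso k.left := inferInstanceAs (IsIso (𝟙 _))
    exact ⟨k, rfl, rfl, fun i hi => hc.projApp_of_le hi,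
      hs.exists_isLimit_of_realizes φ hI k (Iso.refl _) (Category.id_comp _).symm⟩
  · let c : Q ⟶ (⟨I.cx.X 1, Q.D, M, push I.dFirst Q.δ, hM⟩ : DistExangle s) :=
      ⟨I.dFirst, 𝟙 _, hc.incl, (pull_id _).symm⟩
    have : IsIso c.right := inferInstanceAs (IsIso (𝟙 _))
    -- The cokernel criterion wants `I` as a realization of `(φₙ₊₁)^* δ'`, which is the same
    -- extension.
    refine ⟨c, rfl, rfl, ?_, hs.exists_isColimit_of_realizes φ (φ.ext_comm ▸ hI) c
      (Iso.refl _) (Category.comp_id _).symm⟩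
    rintro (_ | i) h₁ _
    · omega
    · rfl
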